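/- Notation. For $A\in\mathbb{R}^{m\times n}$ let $\|A\|_1=\max_j\sum_i|a_{ij}|$ and let $\|A\|_2$ be the spectral norm. For $u\in\mathbb{R}^n$ let $[\mathbf 0,u]=\{x: \mathbf 0\le x\le u\}$. For $\delta>0$, a $\delta$-feasible solution of $Ax=b,\ x\in[\mathbf 0,u]$ is an $x\in[\mathbf 0,u]$ with $\|Ax-b\|_1\le\delta\|A\|_1$. An elementary vector of a linear subspace $W\subseteq\mathbb{R}^N$ is a nonzero vector of $W$ of inclusion-minimal support, and $\kappa(W)=\max\{|g_j/g_i| : g \text{ elementary vector of } W,\ i,j\in\mathrm{supp}(g)\}$, with $\kappa(W)=1$ if $W=\{\mathbf 0\}$ or $W=\mathbb{R}^N$. Let $\mathcal X_A=\ker(A\mid -I_m)\subseteq\mathbb{R}^{n+m}$. R-FGM with parameters $L>0$, $h,k\in\mathbb{N}$, applied to $f(x)=\tfrac12\|Ax-b\|_2^2$ over $[\mathbf 0,u]$ from a starting point $x^0$, performs $k$ rounds of $h$ iterations. A round started at $x$ sets $y=x$, $t=1$; an iteration replaces $(x,y,t)$ by $(x^+,y^+,t^+)$, where $x^+$ is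 the Euclidean projection of $y-\tfrac1L\nabla f(y)$ onto $[\mathbf 0,u]$, $t^+=\tfrac12\bigl(1+\sqrt{1+4t^2}\bigr)$ and $y^+=x^++\tfrac{t-1}{t^+}(x^+-x)$. Each round starts at the last $x$ of the previous one. Algorithm $\mathrm{Feasible}(A,b,u,\delta)$: start with $x=\mathbf 0$ and $q=1$; while $x$ is not $\delta$-feasible, replace $x$ by the output of R-FGM with starting point $\mathbf 0$, $L=\|A\|_2^2$, $h=\lceil 2\mathrm e\,\|A\|_2\,m\,q\rceil$ and $k=\max\{0,\lceil\log(m\|b\|_1/\delta)\rceil\}$, and replace $q$ by $2q$; return $x$. Theorem. There is an absolute constant $C>0$ such that for all $m,n$, all $A\in\mathbb{R}^{m\times n}$ with $\|A\|_1\ge1$, all $b\in\mathbb{R}^m$, $u\in\mathbb{R}^n$ and $\delta>0$ for which the system $Ax=b$, $x\in[\mathbf 0,u]$ is feasible, $\mathrm{Feasible}(A,b,u,\delta)$ terminates and returns a $\delta$-feasible solution, and the total number of iterations of R-FGM that it performs is at most $$C\cdot m\,\|A\|_2\cdot\kappa(\mathcal X_A)\cdot\log\!\left(1+\frac{m\|b\|_1}{\delta}\right).$$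 -/

import Mathlib

namespace FirstOrderLP

/-! ### Norms and approximate feasibility -/

/-- The vector norm `‖v‖₁ = ∑ i, |v i|`. -/
def vecOneNorm {k : ℕ} (v : Fin k → ℝ) : ℝ := ∑ i, |v i|

/-- The matrix norm `‖A‖₁ = max_j ∑ i, |A i j|` (maximum absolute column sum). -/
noncomputable def matOneNorm {m n : ℕ} (A : Matrix (Fin m) (Fin n) ℝ) : ℝ :=
  ⨆ j : Fin n, ∑ i, |A i j|

open scoped Matrix.Norms.L2Operator in
/-- The spectral norm `‖A‖₂`, i.e. the operator norm of `A` with respect to Euclidean norms. -/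
noncomputable def matTwoNorm {m n : ℕ} (A : Matrix (Fin m) (Fin n) ℝ) : ℝ := ‖A‖

/-- `x` is a `δ`-feasible solution of `A x = b`, `0 ≤ x ≤ u`: it lies in the box `[0, u]`, and
`‖A x - b‖₁ ≤ δ ‖A‖₁`. -/
def IsDeltaFeasible {m n : ℕ} (A : Matrix (Fin m) (Fin n) ℝ) (b : Fin m → ℝ) (u : Fin n → ℝ)
    (δ : ℝ) (x : Fin n → ℝ) : Prop :=
  x ∈ Set.Icc 0 u ∧ vecOneNorm (A.mulVec x - b) ≤ δ * matOneNorm A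

/-! ### Circuit imbalances -/

/-- `g` is an elementary vector of the subspace `W`: a nonzero vector of `W` of inclusion-minimal
support. -/
def IsElementary {ι : Type*} (W : Submodule ℝ (ι → ℝ)) (g : ι → ℝ) : Prop :=
  g ∈ W ∧ g ≠ 0 ∧ ∀ h ∈ W, h ≠ 0 → ¬ Function.support h ⊂ Function.support g

/-- The set of ratios `|g j / g i|` over elementary vectors `g` of `W` and `i, j` in the support
of `g`. -/
def circuitRatios {ι : Type*} (W : Submodule ℝ (ι → ℝ)) : Set ℝ :=
  {r | ∃ g, IsElementary W g ∧
    ∃ i ∈ Function.support g, ∃ j ∈ Function.support g, r = |g j / g i|}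

open Classical in
/-- The (fractional) circuit imbalance measure `κ(W)`: the largest of the ratios `|g j / g i|` over
elementary vectors `g` of `W` and indices `i, j` in the support of `g`; it is `1` for the trivial
subspaces `{0}` and `ℝ^ι`. The maximum exists by `circuitImbalance_isGreatest`. -/
noncomputable def circuitImbalance {ι : Type*} [Finite ι] (W : Submodule ℝ (ι → ℝ)) : ℝ :=
  if W = ⊥ ∨ W = ⊤ then 1 else sSup (circuitRatios W)

theorem circuitRatios_finite {ι : Type*} [Finite ι] (W : Submodule ℝ (ι → ℝ)) :
    (circuitRatios W).Finite := by
  have key : circuitRatios W ⊆ ⋃ p : Set ι × ι × ι,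
      {r | ∃ g, IsElementary W g ∧ Function.support g = p.1 ∧ p.2.1 ∈ Function.support g ∧
        r = |g p.2.2 / g p.2.1|} := by
    rintro r ⟨g, hg, i, hi, j, _, rfl⟩
    exact Set.mem_iUnion.2 ⟨(Function.support g, i, j), g, hg, rfl, hi, rfl⟩
  refine Set.Finite.subset (Set.finite_iUnion fun p => Set.Subsingleton.finite ?_) key
  obtain ⟨S, i, j⟩ := p
  rintro r ⟨g, hg, hgS, hgi, rfl⟩ r' ⟨h, hh, hhS, hhi, rfl⟩
  simp only at hgS hgi hhS hhi ⊢
  have hz : g i • h - h i • g = 0 := by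
    by_contra hne
    refine hg.2.2 (g i • h - h i • g)
      (W.sub_mem (W.smul_mem _ hh.1) (W.smul_mem _ hg.1)) hne ⟨fun a ha => ?_, fun hsub => ?_⟩
    · by_contra hga
      have hha : a ∉ Function.support h := by rw [hhS, ← hgS]; exact hga
      simp only [Function.mem_support, not_not] at hga hha
      simp [hga, hha] at ha
    · have := hsub hgi
      simp [mul_comm] at this
  have hj := congrFun hz j
  simp only [Pi.sub_apply, Pi.smul_apply, smul_eq_mul, Pi.zero_apply] at hj
  have h1 : g i ≠ 0 := hgi
  have h2 : h i ≠ 0 := hhi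
  have : g j / g i = h j / h i := by
    field_simp
    linarith
  rw [this]

theorem circuitImbalance_isGreatest {ι : Type*} [Finite ι] (W : Submodule ℝ (ι → ℝ))
    (hbot : W ≠ ⊥) (htop : W ≠ ⊤) : IsGreatest (circuitRatios W) (circuitImbalance W) := by
  have hne : (circuitRatios W).Nonempty := by
    obtain ⟨g₀, hg₀, hg₀'⟩ := W.ne_bot_iff.1 hbot
    obtain ⟨S, ⟨⟨g, hgW, hg0, rfl⟩, hmin⟩⟩ :=
      (Set.toFinite {S : Set ι | ∃ g ∈ W, g ≠ 0 ∧ Function.support g = S}).exists_minimal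
        ⟨_, g₀, hg₀, hg₀', rfl⟩
    obtain ⟨i, hi⟩ := Function.ne_iff.1 hg0
    exact ⟨_, g, ⟨hgW, hg0, fun h hW h0 hss => hss.2 (hmin ⟨h, hW, h0, rfl⟩ hss.1)⟩,
      i, hi, i, hi, rfl⟩
  have hfin := circuitRatios_finite W
  rw [circuitImbalance, if_neg (by simp [hbot, htop])]
  exact ⟨hne.csSup_mem hfin, fun r hr => le_csSup hfin.bddAbove hr⟩

/-- The subspace `𝒳_A = ker (A | -I_m)` of `ℝ^(n+m)`. -/
noncomputable def extendedKernel {m n : ℕ} (A : Matrix (Fin m) (Fin n) ℝ) :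
    Submodule ℝ (Fin n ⊕ Fin m → ℝ) :=
  LinearMap.ker (Matrix.fromCols A (-1 : Matrix (Fin m) (Fin m) ℝ)).mulVecLin

/-! ### The fast gradient method with restarts

The method minimizes a convex `L`-smooth function over a closed convex set. It is given the gradient
`grad` of the function, the Euclidean projection `proj` onto the set, and `L`. -/

/-- State of the method: the current iterate `x`, the extrapolated point `y`, the momentum
parameter `t`, and the number `iters` of iterations carried out so far. -/
structure FGMState (n : ℕ) where
  x : Fin n → ℝ
  y : Fin n → ℝ
  t : ℝ
  iters : ℕ

/-- (Re)start accelerated projected gradient descent at the point `x₀`. The iteration count is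
retained. -/
def FGMState.restartAt {n : ℕ} (s : FGMState n) (x₀ : Fin n → ℝ) : FGMState n :=
  ⟨x₀, x₀, 1, s.iters⟩

/-- One iteration of accelerated projected gradient descent:
`x⁺ = proj (y - L⁻¹ • ∇f(y))`, `t⁺ = (1 + √(1 + 4 t²)) / 2`, `y⁺ = x⁺ + ((t - 1) / t⁺) • (x⁺ - x)`.
This is the only operation that evaluates a gradient, and it increases the iteration count by
one. -/
noncomputable def fgmStep {n : ℕ} (grad proj : (Fin n → ℝ) → (Fin n → ℝ)) (L : ℝ)
    (s : FGMState n) : FGMState n :=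
  let x' := proj (s.y - L⁻¹ • grad s.y)
  let t' := (1 + √(1 + 4 * s.t ^ 2)) / 2
  ⟨x', x' + ((s.t - 1) / t') • (x' - s.x), t', s.iters + 1⟩

/-- One round of R-FGM: restart at the current iterate and carry out `h` iterations. -/
noncomputable def rfgmRound {n : ℕ} (grad proj : (Fin n → ℝ) → (Fin n → ℝ)) (L : ℝ) (h : ℕ)
    (s : FGMState n) : FGMState n :=
  (fgmStep grad proj L)^[h] (s.restartAt s.x)

/-- R-FGM from the starting point `x₀`: `k` rounds of `h` iterations each. -/
noncomputable def rfgm {n : ℕ} (grad proj : (Fin n → ℝ) → (Fin n → ℝ)) (L : ℝ) (h k : ℕ)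
    (x₀ : Fin n → ℝ) (s : FGMState n) : FGMState n :=
  (rfgmRound grad proj L h)^[k] (s.restartAt x₀)

/-! ### The feasibility algorithm -/

/-- The gradient `Aᵀ (A x - b)` of `x ↦ ½ ‖A x - b‖₂²`. -/
def lsqGrad {m n : ℕ} (A : Matrix (Fin m) (Fin n) ℝ) (b : Fin m → ℝ) (x : Fin n → ℝ) :
    Fin n → ℝ :=
  A.transpose.mulVec (A.mulVec x - b)

theorem hasGradientAt_lsq {m n : ℕ} (A : Matrix (Fin m) (Fin n) ℝ) (b : Fin m → ℝ)
    (x : EuclideanSpace ℝ (Fin n)) :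
    HasGradientAt
      (fun z : EuclideanSpace ℝ (Fin n) => (1 / 2 : ℝ) * ∑ i, (A.mulVec z.ofLp - b) i ^ 2)
      (WithLp.toLp 2 (lsqGrad A b x.ofLp)) x := by
  have h1 : HasFDerivAt
      (fun z : EuclideanSpace ℝ (Fin n) => (1 / 2 : ℝ) * ∑ i, (A.mulVec z.ofLp - b) i ^ 2)
      ((1 / 2 : ℝ) • ∑ i, (2 * (A.mulVec x.ofLp - b) i) •
        ∑ j, A i j • (EuclideanSpace.proj j : EuclideanSpace ℝ (Fin n) →L[ℝ] ℝ)) x := by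
    refine HasFDerivAt.const_mul (HasFDerivAt.fun_sum fun i _ => ?_) _
    have h2 : HasFDerivAt (fun z : EuclideanSpace ℝ (Fin n) => (A.mulVec z.ofLp - b) i)
        (∑ j, A i j • (EuclideanSpace.proj j : EuclideanSpace ℝ (Fin n) →L[ℝ] ℝ)) x := by
      simp only [Pi.sub_apply, Matrix.mulVec, dotProduct]
      refine HasFDerivAt.sub_const _ (HasFDerivAt.fun_sum fun j _ => ?_)
      exact (EuclideanSpace.proj j : EuclideanSpace ℝ (Fin n) →L[ℝ] ℝ).hasFDerivAt.const_mul _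
    simpa using h2.pow 2
  rw [hasGradientAt_iff_hasFDerivAt]
  refine h1.congr_fderiv ?_
  ext z
  simp only [InnerProductSpace.toDual_apply_apply, PiLp.inner_apply, lsqGrad, Matrix.mulVec,
    dotProduct, Matrix.transpose_apply, smul_apply, sum_apply, PiLp.proj_apply, smul_eq_mul,
    RCLike.inner_apply, conj_trivial, Finset.mul_sum]
  rw [Finset.sum_comm]
  refine Finset.sum_congr rfl fun i _ => Finset.sum_congr rfl fun j _ => ?_
  ring

/-- The Euclidean projection onto the box `[0, u]`, for `0 ≤ u`. -/
def boxProj {n : ℕ} (u x : Fin n → ℝ) : Fin n → ℝ := fun j => max 0 (min (u j) (x j))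

theorem boxProj_isNearest {n : ℕ} {u : Fin n → ℝ} (hu : 0 ≤ u) (x : Fin n → ℝ) :
    boxProj u x ∈ Set.Icc 0 u ∧
      ∀ z ∈ Set.Icc 0 u, ∑ j, (boxProj u x j - x j) ^ 2 ≤ ∑ j, (z j - x j) ^ 2 := by
  refine ⟨⟨fun j => le_max_left _ _, fun j => max_le (hu j) (min_le_left _ _)⟩,
    fun z hz => Finset.sum_le_sum fun j _ => ?_⟩
  have h0 : 0 ≤ z j := hz.1 j
  have h1 : z j ≤ u j := hz.2 j
  rw [sq_le_sq]
  unfold boxProj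
  rcases le_total (u j) (x j) with h | h
  · rw [min_eq_left h, max_eq_right (h0.trans h1), abs_of_nonpos (by linarith),
      abs_of_nonpos (by linarith)]
    linarith
  · rw [min_eq_right h]
    rcases le_total 0 (x j) with h' | h'
    · rw [max_eq_right h']
      simp
    · rw [max_eq_left h', abs_of_nonneg (by linarith), abs_of_nonneg (by linarith)]
      linarith

/-- One run of R-FGM for minimizing `½ ‖A x - b‖₂²` over `[0, u]`, from the starting point `0`, with
smoothness parameter `L = ‖A‖₂²`, with `⌈2 e ‖A‖₂ m q⌉` iterations per round, where `q` is the
current guess for the circuit imbalance measure `κ(𝒳_A)`, and with `⌈log (m ‖b‖₁ / δ)⌉` rounds. -/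
noncomputable def feasibleAttempt {m n : ℕ} (A : Matrix (Fin m) (Fin n) ℝ) (b : Fin m → ℝ)
    (u : Fin n → ℝ) (δ : ℝ) (q : ℕ) (s : FGMState n) : FGMState n :=
  rfgm (lsqGrad A b) (boxProj u) (matTwoNorm A ^ 2)
    ⌈2 * Real.exp 1 * matTwoNorm A * m * q⌉₊ ⌈Real.log (m * vecOneNorm b / δ)⌉₊ 0 s

/-- Execution of the loop of the algorithm `Feasible(A, b, u, δ)`: with current guess `q` and current
state `s`, it halts if the current iterate is `δ`-feasible; otherwise it runs R-FGM with the guess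
`q`, doubles the guess, and repeats. `FeasibleLoop A b u δ q s s'` says that the loop, entered with
`q` and `s`, terminates in the state `s'`. -/
inductive FeasibleLoop {m n : ℕ} (A : Matrix (Fin m) (Fin n) ℝ) (b : Fin m → ℝ)
    (u : Fin n → ℝ) (δ : ℝ) : ℕ → FGMState n → FGMState n → Prop
  | halt (q : ℕ) (s : FGMState n) (hs : IsDeltaFeasible A b u δ s.x) :
      FeasibleLoop A b u δ q s s
  | retry (q : ℕ) (s s' : FGMState n) (hs : ¬ IsDeltaFeasible A b u δ s.x)
      (hrec : FeasibleLoop A b u δ (2 * q) (feasibleAttempt A b u δ q s) s') :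
      FeasibleLoop A b u δ q s s'

/-- The algorithm `Feasible(A, b, u, δ)`, started at the point `0` with the guess `1` for the circuit
imbalance measure, terminates with output `x` after `N` iterations of R-FGM in total (over all runs
of R-FGM). The algorithm is deterministic, and it is given neither `κ(𝒳_A)` nor any bound on it. -/
def FeasibleReturns {m n : ℕ} (A : Matrix (Fin m) (Fin n) ℝ) (b : Fin m → ℝ)
    (u : Fin n → ℝ) (δ : ℝ) (x : Fin n → ℝ) (N : ℕ) : Prop :=
  ∃ s : FGMState n, FeasibleLoop A b u δ 1 ⟨0, 0, 1, 0⟩ s ∧ s.x = x ∧ s.iters = N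

theorem FeasibleLoop.unique {m n : ℕ} {A : Matrix (Fin m) (Fin n) ℝ} {b : Fin m → ℝ}
    {u : Fin n → ℝ} {δ : ℝ} {q : ℕ} {s s₁ s₂ : FGMState n} (h₁ : FeasibleLoop A b u δ q s s₁)
    (h₂ : FeasibleLoop A b u δ q s s₂) : s₁ = s₂ := by
  induction h₁ with
  | halt q s hs =>
    cases h₂ with
    | halt => rfl
    | retry _ _ _ hs2 => exact absurd hs hs2
  | retry q s s' hs _ ih =>
    cases h₂ with
    | halt _ _ hs' => exact absurd hs' hs
    | retry _ _ _ _ hrec => exact ih hrec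

end FirstOrderLP

/-! Write R(x) for the squared residual of x. Two estimates carry the theorem. Accelerated projected
gradient descent started at x satisfies h² R ≤ 4 L ‖xs - x‖² after h iterations, for every solution
xs in the box (`rfgmRound_spec`). A Hoffman bound provides a solution xs, depending on x, with ‖xs -
x‖² ≤ (m κ)² R(x) (`exists_solution_near`). It comes from a conformal decomposition of (x₀ - x, b -
A x) into elementary vectors of ker (A | -I): those without slack part are discarded, and the others
have length controlled by κ and their slack.

With L = ‖A‖₂² and h ≥ 2 e ‖A‖₂ m κ, the two estimates together make each round shrink R by e², so
the residual norm falls by e and logarithmically many rounds suffice. Hence a run succeeds once q ≥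
κ. Since q doubles, the costs of all runs form a geometric sum dominated by the last guess, which is
below 2κ (`exists_feasibleLoop`). -/

namespace FirstOrderLP

/-! ### Accelerated projected gradient descent: the potential argument -/

/-- The squared Euclidean norm of the residual `A x - b`. -/
def sqResidual {m n : ℕ} (A : Matrix (Fin m) (Fin n) ℝ) (b : Fin m → ℝ) (x : Fin n → ℝ) : ℝ :=
  (A.mulVec x - b) ⬝ᵥ (A.mulVec x - b)

theorem dotProduct_self_nonneg_real {k : ℕ} (v : Fin k → ℝ) : 0 ≤ v ⬝ᵥ v :=
  Finset.sum_nonneg fun i _ => mul_self_nonneg (v i)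

theorem sqResidual_nonneg {m n : ℕ} (A : Matrix (Fin m) (Fin n) ℝ) (b : Fin m → ℝ)
    (x : Fin n → ℝ) : 0 ≤ sqResidual A b x :=
  dotProduct_self_nonneg_real _

theorem sqResidual_add {m n : ℕ} (A : Matrix (Fin m) (Fin n) ℝ) (b : Fin m → ℝ)
    (y v : Fin n → ℝ) :
    sqResidual A b (y + v) =
      sqResidual A b y + 2 * (lsqGrad A b y ⬝ᵥ v) + A.mulVec v ⬝ᵥ A.mulVec v := by
  have h1 : lsqGrad A b y ⬝ᵥ v = (A.mulVec y - b) ⬝ᵥ A.mulVec v := by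
    rw [lsqGrad, Matrix.mulVec_transpose, Matrix.dotProduct_mulVec]
  have h2 : A.mulVec (y + v) - b = (A.mulVec y - b) + A.mulVec v := by
    rw [Matrix.mulVec_add]; abel
  rw [h1, sqResidual, h2, add_dotProduct, dotProduct_add, dotProduct_add,
    dotProduct_comm (A.mulVec v) (A.mulVec y - b), sqResidual]
  ring

theorem boxProj_mem {n : ℕ} {u : Fin n → ℝ} (hu : 0 ≤ u) (x : Fin n → ℝ) :
    boxProj u x ∈ Set.Icc 0 u :=
  (boxProj_isNearest hu x).1

/-- The obtuse-angle property of a projection onto a convex set; for a box it holds in each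
coordinate separately. -/
theorem boxProj_variational {n : ℕ} {u z : Fin n → ℝ} (w : Fin n → ℝ) (hz : z ∈ Set.Icc 0 u) :
    0 ≤ (boxProj u w - w) ⬝ᵥ (z - boxProj u w) := by
  refine Finset.sum_nonneg fun j _ => ?_
  have h0 : 0 ≤ z j := hz.1 j
  have h1 : z j ≤ u j := hz.2 j
  simp only [Pi.sub_apply, boxProj]
  rcases le_total (u j) (w j) with h | h
  · rw [min_eq_left h, max_eq_right (h0.trans h1)]
    nlinarith
  · rw [min_eq_right h]
    rcases le_total 0 (w j) with h' | h'
    · simp [max_eq_right h']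
    · rw [max_eq_left h']
      nlinarith

/-- The basic inequality of a projected gradient step with step size `1 / L`. -/
theorem sqResidual_gradientStep_le {m n : ℕ} {A : Matrix (Fin m) (Fin n) ℝ} {b : Fin m → ℝ}
    {u z y x' : Fin n → ℝ} {L : ℝ} (hL : 0 < L)
    (hA : ∀ v, A.mulVec v ⬝ᵥ A.mulVec v ≤ L * (v ⬝ᵥ v)) (hz : z ∈ Set.Icc 0 u)
    (hx' : x' = boxProj u (y - L⁻¹ • lsqGrad A b y)) :
    sqResidual A b x' + L * ((x' - y) ⬝ᵥ (x' - y)) + 2 * L * ((y - z) ⬝ᵥ (x' - y)) ≤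
      sqResidual A b z := by
  have hproj := boxProj_variational (y - L⁻¹ • lsqGrad A b y) hz
  rw [← hx'] at hproj
  -- The residual is an exact quadratic: its second-order term at y is at most the L-term towards x'
  -- (smoothness) and at least 0 towards z (convexity).
  have e1 := sqResidual_add A b y (x' - y)
  have e2 := sqResidual_add A b y (z - y)
  rw [add_sub_cancel] at e1 e2
  have h1 := hA (x' - y)
  have h2 := dotProduct_self_nonneg_real (A.mulVec (z - y))
  set g := lsqGrad A b y
  have h3 : (x' - (y - L⁻¹ • g)) ⬝ᵥ (z - x') =
      (x' - y) ⬝ᵥ (z - y) - (x' - y) ⬝ᵥ (x' - y) + L⁻¹ * (g ⬝ᵥ (z - y) - g ⬝ᵥ (x' - y)) := by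
    rw [← dotProduct_sub, ← dotProduct_sub, sub_sub_sub_cancel_right, ← smul_eq_mul,
      ← smul_dotProduct, ← add_dotProduct]
    congr 1
    abel
  have h4 : 0 ≤ L * ((x' - y) ⬝ᵥ (z - y) - (x' - y) ⬝ᵥ (x' - y)) +
      (g ⬝ᵥ (z - y) - g ⬝ᵥ (x' - y)) := by
    have := mul_nonneg hL.le (h3 ▸ hproj)
    rwa [mul_add, mul_inv_cancel_left₀ hL.ne'] at this
  have h5 : (y - z) ⬝ᵥ (x' - y) = -((x' - y) ⬝ᵥ (z - y)) := by
    rw [dotProduct_comm, ← neg_sub z y, dotProduct_neg]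
  rw [h5]
  linarith

/-- The potential function of the fast gradient method with respect to the minimizer `xs`. -/
def fgmPotential {m n : ℕ} (A : Matrix (Fin m) (Fin n) ℝ) (b : Fin m → ℝ) (L : ℝ)
    (xs : Fin n → ℝ) (s : FGMState n) : ℝ :=
  (s.t ^ 2 - s.t) * sqResidual A b s.x +
    L * ((s.t • s.y - (s.t - 1) • s.x - xs) ⬝ᵥ (s.t • s.y - (s.t - 1) • s.x - xs))

/-- The new momentum parameter is a root of τ² - τ = t², so the weight of the residual in
`fgmPotential` becomes t² after the step. -/
theorem momentum_sq_sub {t : ℝ} :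
    ((1 + √(1 + 4 * t ^ 2)) / 2) ^ 2 - (1 + √(1 + 4 * t ^ 2)) / 2 = t ^ 2 := by
  have h : √(1 + 4 * t ^ 2) ^ 2 = 1 + 4 * t ^ 2 := Real.sq_sqrt (by positivity)
  linear_combination h / 4

theorem momentum_ge {t : ℝ} : t + 1 / 2 ≤ (1 + √(1 + 4 * t ^ 2)) / 2 := by
  have h : 2 * t ≤ √(1 + 4 * t ^ 2) := Real.le_sqrt_of_sq_le (by nlinarith)
  linarith

theorem fgmPotential_step_le {m n : ℕ} {A : Matrix (Fin m) (Fin n) ℝ} {b : Fin m → ℝ}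
    {u xs : Fin n → ℝ} {L : ℝ} (hL : 0 < L)
    (hA : ∀ v, A.mulVec v ⬝ᵥ A.mulVec v ≤ L * (v ⬝ᵥ v)) (hxs : xs ∈ Set.Icc 0 u)
    (hsol : A.mulVec xs = b) {s : FGMState n} (hx : s.x ∈ Set.Icc 0 u) (ht : 1 ≤ s.t) :
    fgmPotential A b L xs (fgmStep (lsqGrad A b) (boxProj u) L s) ≤ fgmPotential A b L xs s := by
  obtain ⟨x, y, t, N⟩ := s
  simp only at hx ht
  have hR : sqResidual A b xs = 0 := by simp [sqResidual, hsol]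
  set x' := boxProj u (y - L⁻¹ • lsqGrad A b y) with hx'
  -- The step inequality is compared with the current iterate and with the solution; weights t(t -
  -- 1) and t add up to t², the new weight of the residual.
  have i1 := sqResidual_gradientStep_le hL hA hx hx'
  have i2 := sqResidual_gradientStep_le hL hA hxs hx'
  rw [hR] at i2
  have ht' : (1 + √(1 + 4 * t ^ 2)) / 2 ≠ 0 := by positivity
  -- The extrapolation is designed so that the vector in the potential moves by exactly t (x' - y).
  have hU : ((1 + √(1 + 4 * t ^ 2)) / 2) •
        (x' + ((t - 1) / ((1 + √(1 + 4 * t ^ 2)) / 2)) • (x' - x)) -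
        ((1 + √(1 + 4 * t ^ 2)) / 2 - 1) • x' - xs = (t • y - (t - 1) • x - xs) + t • (x' - y) := by
    rw [smul_add, smul_smul, mul_div_cancel₀ _ ht']
    ext j
    simp only [Pi.add_apply, Pi.sub_apply, Pi.smul_apply, smul_eq_mul]
    ring
  simp only [fgmPotential, fgmStep, ← hx', momentum_sq_sub, hU]
  have hUU : ((t • y - (t - 1) • x - xs) + t • (x' - y)) ⬝ᵥ
      ((t • y - (t - 1) • x - xs) + t • (x' - y)) =
      (t • y - (t - 1) • x - xs) ⬝ᵥ (t • y - (t - 1) • x - xs) +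
      t * (t - 1) * ((x' - y) ⬝ᵥ (x' - y) + 2 * ((y - x) ⬝ᵥ (x' - y))) +
      t * ((x' - y) ⬝ᵥ (x' - y) + 2 * ((y - xs) ⬝ᵥ (x' - y))) := by
    simp only [dotProduct, Finset.mul_sum, ← Finset.sum_add_distrib]
    refine Finset.sum_congr rfl fun j _ => ?_
    simp only [Pi.add_apply, Pi.sub_apply, Pi.smul_apply, smul_eq_mul]
    ring
  rw [hUU]
  have j1 := mul_le_mul_of_nonneg_left i1 (mul_nonneg (by linarith : 0 ≤ t) (sub_nonneg.2 ht))
  have j2 := mul_le_mul_of_nonneg_left i2 (by linarith : 0 ≤ t)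
  linarith

theorem fgmStep_iterate_spec {m n : ℕ} {A : Matrix (Fin m) (Fin n) ℝ} {b : Fin m → ℝ}
    {u xs : Fin n → ℝ} {L : ℝ} (hL : 0 < L)
    (hA : ∀ v, A.mulVec v ⬝ᵥ A.mulVec v ≤ L * (v ⬝ᵥ v)) (hxs : xs ∈ Set.Icc 0 u)
    (hsol : A.mulVec xs = b) {s : FGMState n} (hx : s.x ∈ Set.Icc 0 u) (ht : 1 ≤ s.t) (h : ℕ) :
    ((fgmStep (lsqGrad A b) (boxProj u) L)^[h] s).x ∈ Set.Icc 0 u ∧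
    1 + (h : ℝ) / 2 ≤ ((fgmStep (lsqGrad A b) (boxProj u) L)^[h] s).t ∧
    ((fgmStep (lsqGrad A b) (boxProj u) L)^[h] s).iters = s.iters + h ∧
    fgmPotential A b L xs ((fgmStep (lsqGrad A b) (boxProj u) L)^[h] s) ≤
      fgmPotential A b L xs s := by
  induction h with
  | zero => simpa using ⟨hx, ht⟩
  | succ h ih =>
    rw [Function.iterate_succ_apply']
    set s' := (fgmStep (lsqGrad A b) (boxProj u) L)^[h] s
    obtain ⟨h1, h2, h3, h4⟩ := ih
    have hh : (0 : ℝ) ≤ h := h.cast_nonneg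
    refine ⟨boxProj_mem (hxs.1.trans hxs.2) _, ?_, ?_,
      (fgmPotential_step_le hL hA hxs hsol h1 (by linarith)).trans h4⟩
    · have : s'.t + 1 / 2 ≤ (fgmStep (lsqGrad A b) (boxProj u) L s').t :=
        momentum_ge
      push_cast
      linarith
    · simp only [fgmStep, h3]
      ring

theorem rfgmRound_spec {m n : ℕ} {A : Matrix (Fin m) (Fin n) ℝ} {b : Fin m → ℝ}
    {u xs : Fin n → ℝ} {L : ℝ} (hL : 0 < L)
    (hA : ∀ v, A.mulVec v ⬝ᵥ A.mulVec v ≤ L * (v ⬝ᵥ v)) (hxs : xs ∈ Set.Icc 0 u)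
    (hsol : A.mulVec xs = b) {s : FGMState n} (hx : s.x ∈ Set.Icc 0 u) (h : ℕ) :
    (rfgmRound (lsqGrad A b) (boxProj u) L h s).x ∈ Set.Icc 0 u ∧
    (rfgmRound (lsqGrad A b) (boxProj u) L h s).iters = s.iters + h ∧
    (h : ℝ) ^ 2 * sqResidual A b (rfgmRound (lsqGrad A b) (boxProj u) L h s).x ≤
      4 * L * ((xs - s.x) ⬝ᵥ (xs - s.x)) := by
  obtain ⟨h1, h2, h3, h4⟩ := fgmStep_iterate_spec (s := s.restartAt s.x) hL hA hxs hsol hx le_rfl h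
  refine ⟨h1, h3, ?_⟩
  rw [rfgmRound]
  set s' := (fgmStep (lsqGrad A b) (boxProj u) L)^[h] (s.restartAt s.x)
  have e : fgmPotential A b L xs (s.restartAt s.x) = L * ((xs - s.x) ⬝ᵥ (xs - s.x)) := by
    rw [← neg_dotProduct_neg, neg_sub]
    simp [fgmPotential, FGMState.restartAt]
  rw [e, fgmPotential] at h4
  have h5 := mul_nonneg hL.le
    (dotProduct_self_nonneg_real (s'.t • s'.y - (s'.t - 1) • s'.x - xs))
  have hh : (0 : ℝ) ≤ h := h.cast_nonneg
  -- From t ≥ 1 + h/2: t (t - 1) ≥ (1 + h/2)(h/2) ≥ h²/4.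
  have h6 : (h : ℝ) ^ 2 ≤ 4 * (s'.t ^ 2 - s'.t) := by nlinarith
  nlinarith [mul_le_mul_of_nonneg_right h6 (sqResidual_nonneg A b s'.x)]

/-! ### Conformal elementary vectors -/

/-- `g` conforms to `z`: its coordinates have the same signs, wherever they do not vanish. -/
def Conforms {ι : Type*} (g z : ι → ℝ) : Prop :=
  ∀ i, (g i = 0 ∨ 0 < g i * z i)

theorem Conforms.trans {ι : Type*} {f g z : ι → ℝ} (h₁ : Conforms f g) (h₂ : Conforms g z) :
    Conforms f z := by
  intro i
  rcases h₁ i with h | h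
  · exact Or.inl h
  rcases h₂ i with h' | h'
  · simp [h'] at h
  refine Or.inr ?_
  have h0 : 0 < g i ^ 2 := by
    have : g i ≠ 0 := fun h0 => by simp [h0] at h
    positivity
  nlinarith [mul_pos h h']

theorem Conforms.support_subset {ι : Type*} {g z : ι → ℝ} (h : Conforms g z) :
    Function.support g ⊆ Function.support z := by
  intro i hi hz
  rcases h i with h | h
  · exact hi h
  · simp [hz] at h

/-- A multiple of `h` that can be subtracted from `z` conformally, removing a coordinate from the
support. -/
theorem exists_conforms_sub_smul {ι : Type*} [Finite ι] {h z : ι → ℝ}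
    (hsub : Function.support h ⊆ Function.support z) (hpos : ∃ i, 0 < h i * z i) :
    ∃ c : ℝ, 0 < c ∧ (∀ i, z i - c * h i = 0 ∨ 0 < (z i - c * h i) * z i) ∧
      ∃ i ∈ Function.support h, z i - c * h i = 0 := by
  -- Ratio test: c is the smallest z i / h i over coordinates of equal sign, the first moment at
  -- which a coordinate of z - c h reaches zero.
  obtain ⟨i, hi, hmin⟩ := Set.exists_min_image {i | 0 < h i * z i} (fun i => z i / h i)
    (Set.toFinite _) hpos
  have hi' : 0 < h i * z i := hi
  have hhi : h i ≠ 0 := fun h0 => by simp [h0] at hi'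
  have hc : 0 < z i / h i := by
    have : z i / h i = h i * z i / h i ^ 2 := by field_simp
    rw [this]
    positivity
  refine ⟨z i / h i, hc, fun j => ?_, i, hhi, by field_simp; ring⟩
  by_cases hzj : z j = 0
  · have : h j = 0 := by
      by_contra h0
      exact hsub h0 hzj
    simp [hzj, this]
  have hz2 : 0 < z j ^ 2 := by positivity
  rcases le_or_gt (h j * z j) 0 with hj | hj
  · right
    nlinarith [mul_nonneg hc.le (neg_nonneg.2 hj)]
  · have h1 : z i / h i ≤ z j / h j := hmin j hj
    have hhj : h j ≠ 0 := fun h0 => by simp [h0] at hj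
    have h2 : z j / h j * (h j * z j) = z j ^ 2 := by field_simp
    have h3 : 0 ≤ (z j - z i / h i * h j) * z j := by
      nlinarith [mul_le_mul_of_nonneg_right h1 hj.le]
    rcases h3.lt_or_eq with h4 | h4
    · exact Or.inr h4
    · exact Or.inl ((mul_eq_zero.1 h4.symm).resolve_right hzj)

/-- If z is not elementary, subtracting a suitable multiple of a vector of smaller support gives a
vector that conforms to z and has smaller support; induct on the support size. -/
theorem exists_isElementary_conforms {ι : Type*} [Finite ι] {W : Submodule ℝ (ι → ℝ)}
    {z : ι → ℝ} (hz : z ∈ W) (hz0 : z ≠ 0) : ∃ g, IsElementary W g ∧ Conforms g z := by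
  induction hk : (Function.support z).ncard using Nat.strong_induction_on generalizing z with
  | _ k ih =>
  by_cases hel : IsElementary W z
  · exact ⟨z, hel, fun i => (eq_or_ne (z i) 0).imp id fun h => mul_self_pos.2 h⟩
  have : ∃ h ∈ W, h ≠ 0 ∧ Function.support h ⊂ Function.support z := by
    by_contra! hcon
    exact hel ⟨hz, hz0, hcon⟩
  obtain ⟨h, hW, h0, hss⟩ := this
  obtain ⟨h, hW, hss, hpos⟩ : ∃ h ∈ W, Function.support h ⊂ Function.support z ∧
      ∃ i, 0 < h i * z i := by
    obtain ⟨i, hi⟩ := Function.ne_iff.1 h0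
    have hzi : z i ≠ 0 := hss.1 hi
    rcases lt_or_gt_of_ne (mul_ne_zero hi hzi) with hneg | hpos
    · exact ⟨-h, W.neg_mem hW, by simpa [Function.support_neg] using hss, i, by simpa using hneg⟩
    · exact ⟨h, hW, hss, i, hpos⟩
  obtain ⟨c, -, hconf, i, hi, hzero⟩ := exists_conforms_sub_smul hss.1 hpos
  have hconf' : Conforms (z - c • h) z := hconf
  -- A coordinate of z outside the support of h survives the subtraction, so the difference is
  -- nonzero.
  obtain ⟨j, hjz, hjh⟩ := Set.exists_of_ssubset hss
  have hne : z - c • h ≠ 0 := by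
    intro h0
    have := congrFun h0 j
    simp only [Function.mem_support, not_not] at hjh hjz
    simp [hjh, hjz] at this
  have hlt : (Function.support (z - c • h)).ncard < k := by
    rw [← hk]
    refine Set.ncard_lt_ncard ⟨hconf'.support_subset, fun hsup => ?_⟩ (Set.toFinite _)
    exact hsup (hss.1 hi) hzero
  obtain ⟨g, hg, hgc⟩ := ih _ hlt (W.sub_mem hz (W.smul_mem c hW)) hne rfl
  exact ⟨g, hg, hgc.trans hconf'⟩

/-! ### Circuit imbalance and the Hoffman bound -/

theorem mem_extendedKernel {m n : ℕ} {A : Matrix (Fin m) (Fin n) ℝ} {z : Fin n ⊕ Fin m → ℝ} :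
    z ∈ extendedKernel A ↔ A.mulVec (z ∘ Sum.inl) = z ∘ Sum.inr := by
  rw [extendedKernel, LinearMap.mem_ker, Matrix.mulVecLin_apply, Matrix.fromCols_mulVec,
    Matrix.neg_mulVec, Matrix.one_mulVec, ← sub_eq_add_neg, sub_eq_zero]

/-- Rules out the default value of `circuitImbalance` at ⊤ whenever there is a slack coordinate. -/
theorem extendedKernel_ne_top {m n : ℕ} (A : Matrix (Fin m) (Fin n) ℝ) (i : Fin m) :
    extendedKernel A ≠ ⊤ := by
  intro htop
  have h : (Sum.elim 0 (fun _ => 1) : Fin n ⊕ Fin m → ℝ) ∈ extendedKernel A := htop ▸ trivial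
  rw [mem_extendedKernel] at h
  have := congrFun h i
  simp [Sum.elim_comp_inl] at this

theorem abs_le_circuitImbalance_mul {m n : ℕ} {A : Matrix (Fin m) (Fin n) ℝ}
    {g : Fin n ⊕ Fin m → ℝ} (hg : IsElementary (extendedKernel A) g) {i : Fin m}
    (hi : g (Sum.inr i) ≠ 0) (j : Fin n ⊕ Fin m) :
    |g j| ≤ circuitImbalance (extendedKernel A) * |g (Sum.inr i)| := by
  have hgr := circuitImbalance_isGreatest (extendedKernel A)
    (fun hbot => hg.2.1 (by simpa [hbot] using hg.1)) (extendedKernel_ne_top A i)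
  have hi' : 0 < |g (Sum.inr i)| := abs_pos.2 hi
  rw [← div_le_iff₀ hi', ← abs_div]
  by_cases hj : g j = 0
  · have h1 := hgr.2 ⟨g, hg, Sum.inr i, hi, Sum.inr i, hi, rfl⟩
    rw [hj, zero_div, abs_zero]
    exact (abs_nonneg _).trans h1
  · exact hgr.2 ⟨g, hg, Sum.inr i, hi, j, hj, rfl⟩

theorem one_le_circuitImbalance {ι : Type*} [Finite ι] (W : Submodule ℝ (ι → ℝ)) :
    1 ≤ circuitImbalance W := by
  by_cases h : W = ⊥ ∨ W = ⊤
  · rw [circuitImbalance, if_pos h]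
  · push Not at h
    have hgr := circuitImbalance_isGreatest W h.1 h.2
    obtain ⟨g, hg, i, hi, -⟩ := hgr.1
    refine hgr.2 ⟨g, hg, i, hi, i, hi, ?_⟩
    rw [div_self hi, abs_one]

/-- An elementary vector of `ker (A | -I)` with a nonzero slack part has at most `m` nonzero
coordinates outside that part. -/
theorem card_support_inl_le {m n : ℕ} {A : Matrix (Fin m) (Fin n) ℝ}
    {g : Fin n ⊕ Fin m → ℝ} (hg : IsElementary (extendedKernel A) g) {i : Fin m}
    (hi : g (Sum.inr i) ≠ 0) :
    (Finset.univ.filter fun j => g (Sum.inl j) ≠ 0).card ≤ m := by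
  classical
  set S := Finset.univ.filter fun j => g (Sum.inl j) ≠ 0
  -- A dependency among these columns, extended by zero, would be a kernel vector without slack; its
  -- support lies in that of g and misses the slack index i, contradicting minimality.
  have hli : LinearIndependent ℝ (fun j : S => A.col j) := by
    rw [Fintype.linearIndependent_iff]
    intro c hc
    by_contra! hne
    obtain ⟨j₀, hj₀⟩ := hne
    let d : Fin n → ℝ := fun j => if h : j ∈ S then c ⟨j, h⟩ else 0
    have hd : A.mulVec d = 0 := by
      rw [← hc]
      ext k
      simp only [Matrix.mulVec, dotProduct, Finset.sum_apply, Pi.smul_apply, smul_eq_mul,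
        Matrix.col_apply]
      rw [← Finset.sum_subset (Finset.subset_univ S), ← Finset.sum_coe_sort S]
      · refine Finset.sum_congr rfl fun j _ => ?_
        simp [d, mul_comm]
      · intro j _ hj
        simp [d, hj]
    refine hg.2.2 (Sum.elim d 0) (mem_extendedKernel.2 (by simpa using hd)) ?_ ⟨?_, ?_⟩
    · intro h0
      have := congrFun h0 (Sum.inl j₀.1)
      simp [d, hj₀] at this
    · rintro (j | j) hj
      · by_contra hgj
        have : j ∉ S := by simpa [S] using hgj
        simp [d, this] at hj
      · simp at hj
    · intro hsup
      exact absurd (hsup (show Sum.inr i ∈ Function.support g from hi)) (by simp)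
  have := hli.fintype_card_le_finrank
  simpa using this

theorem vecOneNorm_nonneg {k : ℕ} (v : Fin k → ℝ) : 0 ≤ vecOneNorm v :=
  Finset.sum_nonneg fun i _ => abs_nonneg (v i)

theorem abs_le_vecOneNorm {k : ℕ} (v : Fin k → ℝ) (i : Fin k) : |v i| ≤ vecOneNorm v :=
  Finset.single_le_sum (f := fun i => |v i|) (fun i _ => abs_nonneg (v i)) (Finset.mem_univ i)

theorem norm_toLp_sq {k : ℕ} (v : Fin k → ℝ) : ‖WithLp.toLp 2 v‖ ^ 2 = v ⬝ᵥ v := by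
  rw [EuclideanSpace.real_norm_sq_eq]
  exact Finset.sum_congr rfl fun i _ => sq (v i)

/-- At most m coordinates are nonzero, and each is at most κ times one slack entry, hence κ times
the slack norm. -/
theorem norm_inl_le {m n : ℕ} {A : Matrix (Fin m) (Fin n) ℝ}
    {g : Fin n ⊕ Fin m → ℝ} (hg : IsElementary (extendedKernel A) g) {i : Fin m}
    (hi : g (Sum.inr i) ≠ 0) :
    ‖WithLp.toLp 2 (g ∘ Sum.inl)‖ ≤
      √m * circuitImbalance (extendedKernel A) * vecOneNorm (g ∘ Sum.inr) := by
  set κ := circuitImbalance (extendedKernel A)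
  have hκ : 0 ≤ κ := zero_le_one.trans (one_le_circuitImbalance _)
  have hv := vecOneNorm_nonneg (g ∘ Sum.inr)
  refine le_of_sq_le_sq ?_ (by positivity)
  rw [norm_toLp_sq, mul_pow, mul_pow, Real.sq_sqrt m.cast_nonneg, dotProduct,
    ← Finset.sum_subset (Finset.subset_univ (Finset.univ.filter fun j => g (Sum.inl j) ≠ 0))]
  · refine (Finset.sum_le_card_nsmul _ _ ((κ * vecOneNorm (g ∘ Sum.inr)) ^ 2) ?_).trans ?_
    · intro j _
      rw [← sq]
      refine sq_le_sq' ?_ ?_ <;>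
      · have h1 := abs_le_circuitImbalance_mul hg hi (Sum.inl j)
        have h2 := mul_le_mul_of_nonneg_left (abs_le_vecOneNorm (g ∘ Sum.inr) i) hκ
        have h3 := abs_le.1 (h1.trans h2)
        simp only [Function.comp_apply] at h3 ⊢
        linarith [h3.1, h3.2]
    · rw [nsmul_eq_mul, mul_pow, mul_assoc]
      gcongr
      exact card_support_inl_le hg hi
  · intro j _ hj
    simp only [Finset.mem_filter, Finset.mem_univ, true_and, not_not] at hj
    simp [hj]

/-- A proximity theorem: `z ∈ ker (A | -I)` can be reduced, coordinatewise towards zero, to a vector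
with the same slack part whose remaining part is bounded in terms of the slack part. -/
theorem exists_bounded_part {m n : ℕ} {A : Matrix (Fin m) (Fin n) ℝ}
    {z : Fin n ⊕ Fin m → ℝ} (hz : z ∈ extendedKernel A) :
    ∃ d : Fin n → ℝ, A.mulVec d = z ∘ Sum.inr ∧
      (∀ j, min 0 (z (Sum.inl j)) ≤ d j ∧ d j ≤ max 0 (z (Sum.inl j))) ∧
      ‖WithLp.toLp 2 d‖ ≤
        √m * circuitImbalance (extendedKernel A) * vecOneNorm (z ∘ Sum.inr) := by
  induction hk : (Function.support z).ncard using Nat.strong_induction_on generalizing z with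
  | _ k ih =>
  by_cases hz0 : z = 0
  · subst hz0
    refine ⟨0, by ext; simp, fun j => by simp, by simp [vecOneNorm]⟩
  obtain ⟨g, hg, hgz⟩ := exists_isElementary_conforms hz hz0
  have hpos : ∃ i, 0 < g i * z i := by
    obtain ⟨i, hi⟩ := Function.ne_iff.1 hg.2.1
    exact ⟨i, (hgz i).resolve_left hi⟩
  obtain ⟨c, hc, hconf, i, hi, hzero⟩ := exists_conforms_sub_smul hgz.support_subset hpos
  have hconf' : Conforms (z - c • g) z := hconf
  have hlt : (Function.support (z - c • g)).ncard < k := by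
    rw [← hk]
    refine Set.ncard_lt_ncard ⟨hconf'.support_subset, fun hsup => ?_⟩ (Set.toFinite _)
    exact hsup (hgz.support_subset hi) hzero
  obtain ⟨d, hd, hdz, hdn⟩ := ih _ hlt
    ((extendedKernel A).sub_mem hz ((extendedKernel A).smul_mem c hg.1)) rfl
  have hAg := mem_extendedKernel.1 hg.1
  -- Conformity excludes cancellation, so the 1-norm of the slack is additive; this keeps the final
  -- bound independent of the number of summands.
  have hsplit : vecOneNorm (z ∘ Sum.inr) =
      vecOneNorm ((z - c • g) ∘ Sum.inr) + c * vecOneNorm (g ∘ Sum.inr) := by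
    simp only [vecOneNorm, Finset.mul_sum, ← Finset.sum_add_distrib]
    refine Finset.sum_congr rfl fun j _ => ?_
    have h1 := hgz (Sum.inr j)
    have h2 := hconf (Sum.inr j)
    simp only [Function.comp_apply, Pi.sub_apply, Pi.smul_apply, smul_eq_mul] at h1 h2 ⊢
    rcases lt_trichotomy (z (Sum.inr j)) 0 with h | h | h
    · have a1 : g (Sum.inr j) ≤ 0 := by
        rcases h1 with h1 | h1
        · exact h1.le
        · nlinarith
      have a2 : z (Sum.inr j) - c * g (Sum.inr j) ≤ 0 := by
        rcases h2 with h2 | h2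
        · exact h2.le
        · nlinarith
      rw [abs_of_neg h, abs_of_nonpos a1, abs_of_nonpos a2]
      ring
    · have a1 : g (Sum.inr j) = 0 := by simpa [h] using h1
      simp [h, a1]
    · have a1 : 0 ≤ g (Sum.inr j) := by
        rcases h1 with h1 | h1
        · exact h1.ge
        · nlinarith
      have a2 : 0 ≤ z (Sum.inr j) - c * g (Sum.inr j) := by
        rcases h2 with h2 | h2
        · exact h2.ge
        · nlinarith
      rw [abs_of_pos h, abs_of_nonneg a1, abs_of_nonneg a2]
      ring
  have hbd : ∀ j, (min 0 (z (Sum.inl j)) ≤ d j ∧ d j ≤ max 0 (z (Sum.inl j))) ∧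
      (min 0 (z (Sum.inl j)) ≤ d j + c * g (Sum.inl j) ∧
        d j + c * g (Sum.inl j) ≤ max 0 (z (Sum.inl j))) := by
    intro j
    have h1 := hgz (Sum.inl j)
    have h2 := hconf (Sum.inl j)
    have h3 := hdz j
    simp only [Pi.sub_apply, Pi.smul_apply, smul_eq_mul] at h3
    rcases lt_trichotomy (z (Sum.inl j)) 0 with h | h | h
    · have a1 : c * g (Sum.inl j) ≤ 0 := by
        rcases h1 with h1 | h1
        · simp [h1]
        · nlinarith
      have a2 : z (Sum.inl j) - c * g (Sum.inl j) ≤ 0 := by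
        rcases h2 with h2 | h2
        · exact h2.le
        · nlinarith
      rw [min_eq_right a2, max_eq_left a2] at h3
      rw [min_eq_right h.le, max_eq_left h.le]
      exact ⟨⟨by linarith, by linarith⟩, by linarith, by linarith⟩
    · have a1 : g (Sum.inl j) = 0 := by simpa [h] using h1
      simp only [h, a1, mul_zero, sub_zero, add_zero] at h3 ⊢
      exact ⟨h3, h3⟩
    · have a1 : 0 ≤ c * g (Sum.inl j) := by
        rcases h1 with h1 | h1
        · simp [h1]
        · nlinarith
      have a2 : 0 ≤ z (Sum.inl j) - c * g (Sum.inl j) := by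
        rcases h2 with h2 | h2
        · exact h2.ge
        · nlinarith
      rw [min_eq_left a2, max_eq_right a2] at h3
      rw [min_eq_left h.le, max_eq_right h.le]
      exact ⟨⟨by linarith, by linarith⟩, by linarith, by linarith⟩
  -- A summand without slack is dropped: it changes neither A d nor the slack budget.
  by_cases hs : g ∘ Sum.inr = 0
  · refine ⟨d, ?_, fun j => (hbd j).1, ?_⟩
    · rw [hd]
      ext j
      have := congrFun hs j
      simp only [Function.comp_apply, Pi.zero_apply] at this
      simp [this]
    · rw [hsplit, hs]
      simpa [vecOneNorm] using hdn
  · obtain ⟨l, hl⟩ := Function.ne_iff.1 hs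
    refine ⟨d + c • (g ∘ Sum.inl), ?_, fun j => (hbd j).2, ?_⟩
    · rw [Matrix.mulVec_add, Matrix.mulVec_smul, hd, hAg]
      ext j
      simp
    · have h1 := norm_inl_le hg hl
      rw [WithLp.toLp_add, WithLp.toLp_smul]
      refine (norm_add_le _ _).trans ?_
      rw [norm_smul, Real.norm_of_nonneg hc.le, hsplit]
      nlinarith [mul_le_mul_of_nonneg_left h1 hc.le]

theorem vecOneNorm_sq_le {k : ℕ} (v : Fin k → ℝ) : vecOneNorm v ^ 2 ≤ k * (v ⬝ᵥ v) := by
  have := sq_sum_le_card_mul_sum_sq (s := Finset.univ) (f := fun i => |v i|)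
  simpa [vecOneNorm, dotProduct, sq] using this

/-- A Hoffman-type error bound in terms of the circuit imbalance measure. -/
theorem exists_solution_near {m n : ℕ} {A : Matrix (Fin m) (Fin n) ℝ} {b : Fin m → ℝ}
    {u x x₀ : Fin n → ℝ} (hx₀ : x₀ ∈ Set.Icc 0 u) (hsol : A.mulVec x₀ = b)
    (hx : x ∈ Set.Icc 0 u) :
    ∃ xs ∈ Set.Icc 0 u, A.mulVec xs = b ∧
      (xs - x) ⬝ᵥ (xs - x) ≤
        (m * circuitImbalance (extendedKernel A)) ^ 2 * sqResidual A b x := by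
  -- The reduced first part d keeps x + d between x and x₀ in each coordinate, hence in the box.
  -- Passing from the 1-norm to the 2-norm of the slack costs a second factor √m.
  have hz : Sum.elim (x₀ - x) (b - A.mulVec x) ∈ extendedKernel A := by
    rw [mem_extendedKernel, Sum.elim_comp_inl, Sum.elim_comp_inr, Matrix.mulVec_sub, hsol]
  obtain ⟨d, hd, hdz, hdn⟩ := exists_bounded_part hz
  simp only [Sum.elim_comp_inr, Sum.elim_inl, Pi.sub_apply] at hd hdz hdn
  refine ⟨x + d, ⟨fun j => ?_, fun j => ?_⟩, ?_, ?_⟩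
  · have h1 : 0 ≤ x₀ j := hx₀.1 j
    have h2 : 0 ≤ x j := hx.1 j
    have h3 := (hdz j).1
    simp only [Pi.zero_apply, Pi.add_apply]
    rcases min_le_iff.1 h3 with h | h <;> linarith
  · have h1 : x₀ j ≤ u j := hx₀.2 j
    have h2 : x j ≤ u j := hx.2 j
    have h3 := (hdz j).2
    simp only [Pi.add_apply]
    rcases le_max_iff.1 h3 with h | h <;> linarith
  · rw [Matrix.mulVec_add, hd]
    abel
  · rw [add_sub_cancel_left, ← norm_toLp_sq]
    refine (pow_le_pow_left₀ (norm_nonneg _) hdn 2).trans ?_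
    have h1 := vecOneNorm_sq_le (b - A.mulVec x)
    have h2 : (b - A.mulVec x) ⬝ᵥ (b - A.mulVec x) = sqResidual A b x := by
      rw [← neg_dotProduct_neg, neg_sub, sqResidual]
    rw [h2] at h1
    rw [mul_pow, mul_pow, Real.sq_sqrt m.cast_nonneg]
    calc (m : ℝ) * circuitImbalance (extendedKernel A) ^ 2 * vecOneNorm (b - A.mulVec x) ^ 2
        ≤ m * circuitImbalance (extendedKernel A) ^ 2 * (m * sqResidual A b x) := by gcongr
      _ = _ := by ring

/-! ### Matrix norms -/

open scoped Matrix.Norms.L2Operator in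
theorem mulVec_dotProduct_self_le {m n : ℕ} (A : Matrix (Fin m) (Fin n) ℝ) (v : Fin n → ℝ) :
    A.mulVec v ⬝ᵥ A.mulVec v ≤ matTwoNorm A ^ 2 * (v ⬝ᵥ v) := by
  have h := Matrix.l2_opNorm_mulVec A (WithLp.toLp 2 v)
  have h2 := pow_le_pow_left₀ (norm_nonneg _) h 2
  rw [mul_pow, norm_toLp_sq v] at h2
  exact (norm_toLp_sq (A.mulVec v)).symm.le.trans h2

open scoped Matrix.Norms.L2Operator in
theorem matTwoNorm_nonneg {m n : ℕ} (A : Matrix (Fin m) (Fin n) ℝ) : 0 ≤ matTwoNorm A :=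
  norm_nonneg A

/-- A largest column is the image of a unit vector, and Cauchy–Schwarz compares its 1-norm and
2-norm. -/
theorem matOneNorm_sq_le {m n : ℕ} (A : Matrix (Fin m) (Fin n) ℝ) :
    matOneNorm A ^ 2 ≤ m * matTwoNorm A ^ 2 := by
  rcases isEmpty_or_nonempty (Fin n) with hn | hn
  · rw [matOneNorm, Real.iSup_of_isEmpty, zero_pow two_ne_zero]
    positivity
  obtain ⟨j, hj⟩ := exists_eq_ciSup_of_finite (f := fun j : Fin n => ∑ i, |A i j|)
  have h1 : matOneNorm A = vecOneNorm (A.mulVec (Pi.single j 1)) := by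
    rw [matOneNorm, ← hj, Matrix.mulVec_single_one]
    rfl
  rw [h1]
  refine (vecOneNorm_sq_le _).trans ?_
  gcongr
  simpa using mulVec_dotProduct_self_le A (Pi.single j 1)

/-- Gives L > 0, and lets the rounding in the number of iterations per round be absorbed into a
constant. -/
theorem one_le_card_mul_matTwoNorm {m n : ℕ} {A : Matrix (Fin m) (Fin n) ℝ}
    (hA : 1 ≤ matOneNorm A) : 0 < matTwoNorm A ∧ 1 ≤ m * matTwoNorm A := by
  have h1 := matOneNorm_sq_le A
  have h2 := matTwoNorm_nonneg A
  have h3 : (1 : ℝ) ≤ m * matTwoNorm A ^ 2 := by nlinarith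
  have hm : (1 : ℝ) ≤ m := by
    rcases Nat.eq_zero_or_pos m with h | h
    · subst h
      norm_num at h3
    · exact_mod_cast h
  refine ⟨h2.lt_of_ne fun h0 => ?_, ?_⟩
  · rw [← h0] at h3
    norm_num at h3
  · have h4 : (1 : ℝ) ≤ (m * matTwoNorm A) ^ 2 := by
      rw [mul_pow]
      nlinarith [sq_nonneg (matTwoNorm A)]
    exact (one_le_sq_iff₀ (by positivity)).1 h4

/-! ### Linear convergence of the restarted method -/

/-- A round of sufficiently many iterations reduces the residual by the factor `e`. -/
theorem rfgmRound_sqResidual_le {m n : ℕ} {A : Matrix (Fin m) (Fin n) ℝ} {b : Fin m → ℝ}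
    {u x₀ : Fin n → ℝ} (hA : 1 ≤ matOneNorm A) (hx₀ : x₀ ∈ Set.Icc 0 u)
    (hsol : A.mulVec x₀ = b) {s : FGMState n} (hx : s.x ∈ Set.Icc 0 u) {h : ℕ}
    (hh : 2 * Real.exp 1 * matTwoNorm A * m * circuitImbalance (extendedKernel A) ≤ h) :
    sqResidual A b (rfgmRound (lsqGrad A b) (boxProj u) (matTwoNorm A ^ 2) h s).x ≤
      Real.exp (-1) ^ 2 * sqResidual A b s.x := by
  obtain ⟨hA0, hA1⟩ := one_le_card_mul_matTwoNorm hA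
  have hκ := one_le_circuitImbalance (extendedKernel A)
  -- The comparison solution is chosen anew for each round, close to its starting point.
  obtain ⟨xs, hxs, hxsol, hdist⟩ := exists_solution_near hx₀ hsol hx
  have h1 := (rfgmRound_spec (pow_pos hA0 2) (mulVec_dotProduct_self_le A) hxs hxsol hx h).2.2
  set R' := sqResidual A b (rfgmRound (lsqGrad A b) (boxProj u) (matTwoNorm A ^ 2) h s).x
  have hR' : 0 ≤ R' := sqResidual_nonneg _ _ _
  set κ := circuitImbalance (extendedKernel A)
  set T := 2 * matTwoNorm A * m * κ with hT
  have hTpos : 0 < T := by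
    have : T = 2 * (m * matTwoNorm A) * κ := by rw [hT]; ring
    rw [this]
    positivity
  have h2 : Real.exp 1 * T ≤ h := by
    rw [hT]
    linarith
  have h3 : (Real.exp 1 * T) ^ 2 * R' ≤ T ^ 2 * sqResidual A b s.x := by
    calc (Real.exp 1 * T) ^ 2 * R' ≤ (h : ℝ) ^ 2 * R' := by gcongr
      _ ≤ 4 * matTwoNorm A ^ 2 * ((xs - s.x) ⬝ᵥ (xs - s.x)) := h1
      _ ≤ 4 * matTwoNorm A ^ 2 * ((m * κ) ^ 2 * sqResidual A b s.x) := by gcongr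
      _ = _ := by rw [hT]; ring
  have h4 : T ^ 2 * (Real.exp 1 ^ 2 * R') ≤ T ^ 2 * sqResidual A b s.x := by linarith
  have h5 := le_of_mul_le_mul_left h4 (by positivity)
  rw [Real.exp_neg, inv_pow, ← div_eq_inv_mul, le_div_iff₀ (by positivity)]
  linarith

/-- Only the decay needs h large: the iteration count must also cover runs whose guess is too small.
-/
theorem rfgmRound_iterate_spec {m n : ℕ} {A : Matrix (Fin m) (Fin n) ℝ} {b : Fin m → ℝ}
    {u x₀ : Fin n → ℝ} (hA : 1 ≤ matOneNorm A) (hx₀ : x₀ ∈ Set.Icc 0 u)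
    (hsol : A.mulVec x₀ = b) {s : FGMState n} (hx : s.x ∈ Set.Icc 0 u) (h k : ℕ) :
    ((rfgmRound (lsqGrad A b) (boxProj u) (matTwoNorm A ^ 2) h)^[k] s).x ∈ Set.Icc 0 u ∧
    ((rfgmRound (lsqGrad A b) (boxProj u) (matTwoNorm A ^ 2) h)^[k] s).iters = s.iters + k * h ∧
    (2 * Real.exp 1 * matTwoNorm A * m * circuitImbalance (extendedKernel A) ≤ h →
      sqResidual A b ((rfgmRound (lsqGrad A b) (boxProj u) (matTwoNorm A ^ 2) h)^[k] s).x ≤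
        (Real.exp (-1) ^ 2) ^ k * sqResidual A b s.x) := by
  have hA0 := (one_le_card_mul_matTwoNorm hA).1
  induction k with
  | zero => simpa using hx
  | succ k ih =>
    rw [Function.iterate_succ_apply']
    obtain ⟨h1, h2, h3⟩ := ih
    obtain ⟨r1, r2, -⟩ :=
      rfgmRound_spec (pow_pos hA0 2) (mulVec_dotProduct_self_le A) hx₀ hsol h1 h
    refine ⟨r1, ?_, fun hh => ?_⟩
    · rw [r2, h2]
      ring
    · refine (rfgmRound_sqResidual_le hA hx₀ hsol h1 hh).trans ?_
      rw [pow_succ' _ k, mul_assoc]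
      exact mul_le_mul_of_nonneg_left (h3 hh) (by positivity)

theorem dotProduct_self_le_vecOneNorm_sq {k : ℕ} (v : Fin k → ℝ) :
    v ⬝ᵥ v ≤ vecOneNorm v ^ 2 := by
  rw [sq, dotProduct]
  conv_rhs => rw [vecOneNorm, Finset.sum_mul]
  refine Finset.sum_le_sum fun i _ => ?_
  rw [← abs_mul_abs_self]
  exact mul_le_mul_of_nonneg_left (abs_le_vecOneNorm v i) (abs_nonneg _)

theorem feasibleAttempt_iters {m n : ℕ} {A : Matrix (Fin m) (Fin n) ℝ} {b : Fin m → ℝ}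
    {u x₀ : Fin n → ℝ} {δ : ℝ} (hA : 1 ≤ matOneNorm A) (hx₀ : x₀ ∈ Set.Icc 0 u)
    (hsol : A.mulVec x₀ = b) (q : ℕ) (s : FGMState n) :
    (feasibleAttempt A b u δ q s).iters = s.iters +
      ⌈Real.log (m * vecOneNorm b / δ)⌉₊ * ⌈2 * Real.exp 1 * matTwoNorm A * m * q⌉₊ :=
  (rfgmRound_iterate_spec (s := s.restartAt 0) hA hx₀ hsol ⟨le_rfl, hx₀.1.trans hx₀.2⟩ _ _).2.1

/-- A run of R-FGM is successful if the guess `q` is at least the circuit imbalance measure. -/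
theorem feasibleAttempt_isDeltaFeasible {m n : ℕ} {A : Matrix (Fin m) (Fin n) ℝ} {b : Fin m → ℝ}
    {u x₀ : Fin n → ℝ} {δ : ℝ} (hA : 1 ≤ matOneNorm A) (hδ : 0 < δ) (hx₀ : x₀ ∈ Set.Icc 0 u)
    (hsol : A.mulVec x₀ = b) {q : ℕ} (hq : circuitImbalance (extendedKernel A) ≤ q)
    (s : FGMState n) : IsDeltaFeasible A b u δ (feasibleAttempt A b u δ q s).x := by
  obtain ⟨hA0, hA1⟩ := one_le_card_mul_matTwoNorm hA
  set k := ⌈Real.log (m * vecOneNorm b / δ)⌉₊ with hk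
  obtain ⟨h1, -, h3⟩ := rfgmRound_iterate_spec (s := s.restartAt 0) hA hx₀ hsol
    ⟨le_rfl, hx₀.1.trans hx₀.2⟩ ⌈2 * Real.exp 1 * matTwoNorm A * m * q⌉₊ k
  refine ⟨h1, ?_⟩
  have hb := vecOneNorm_nonneg b
  have hR := h3 (le_trans (by gcongr) (Nat.le_ceil _))
  change sqResidual A b (feasibleAttempt A b u δ q s).x ≤ _ * sqResidual A b 0 at hR
  set x := (feasibleAttempt A b u δ q s).x
  have hR0 : sqResidual A b 0 ≤ vecOneNorm b ^ 2 := by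
    simpa [sqResidual] using dotProduct_self_le_vecOneNorm_sq b
  have hdecay : Real.exp (-1) ^ k * (m * vecOneNorm b) ≤ δ := by
    -- The logarithm bounds its argument only when that is positive; for m ‖b‖₁ = 0 the claim is
    -- trivial.
    rcases (mul_nonneg m.cast_nonneg hb : 0 ≤ (m : ℝ) * vecOneNorm b).eq_or_lt with h0 | hpos
    · rw [← h0, mul_zero]
      exact hδ.le
    · have e1 : m * vecOneNorm b / δ ≤ Real.exp k :=
        (Real.log_le_iff_le_exp (by positivity)).1 (Nat.le_ceil _)
      rw [div_le_iff₀ hδ] at e1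
      rw [Real.exp_neg, inv_pow, ← Real.exp_nat_mul, mul_one, inv_mul_le_iff₀ (Real.exp_pos _)]
      exact e1
  have hsq : vecOneNorm (A.mulVec x - b) ^ 2 ≤ δ ^ 2 := by
    have hm : (m : ℝ) ≤ m ^ 2 := by exact_mod_cast Nat.le_self_pow two_ne_zero m
    calc vecOneNorm (A.mulVec x - b) ^ 2 ≤ m * sqResidual A b x := vecOneNorm_sq_le _
      _ ≤ m ^ 2 * ((Real.exp (-1) ^ 2) ^ k * vecOneNorm b ^ 2) := by
        refine mul_le_mul hm (hR.trans ?_) (sqResidual_nonneg _ _ _) (by positivity)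
        gcongr
      _ = (Real.exp (-1) ^ k * (m * vecOneNorm b)) ^ 2 := by ring
      _ ≤ δ ^ 2 := by gcongr
  exact (le_of_sq_le_sq hsq hδ.le).trans (le_mul_of_one_le_right hδ.le hA)

/-! ### The doubling search and the final count -/

/-- The doubling search for the circuit imbalance measure terminates, and costs at most a constant
factor more than a run with the correct guess. -/
theorem exists_feasibleLoop {m n : ℕ} {A : Matrix (Fin m) (Fin n) ℝ} {b : Fin m → ℝ}
    {u : Fin n → ℝ} {δ κ c : ℝ} (hc : 0 ≤ c)
    (hcost : ∀ (q : ℕ) (s : FGMState n), 1 ≤ q →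
      ((feasibleAttempt A b u δ q s).iters : ℝ) ≤ s.iters + c * q)
    (hgood : ∀ (q : ℕ) (s : FGMState n), κ ≤ q →
      IsDeltaFeasible A b u δ (feasibleAttempt A b u δ q s).x)
    (d q : ℕ) (s : FGMState n) (hq : 1 ≤ q) (hqκ : (q : ℝ) ≤ 2 * κ) (hd : κ ≤ 2 ^ d * q) :
    ∃ s', FeasibleLoop A b u δ q s s' ∧ IsDeltaFeasible A b u δ s'.x ∧
      (s'.iters : ℝ) ≤ s.iters + c * (4 * κ - q) := by
  -- d bounds the doublings still needed to reach κ. The budget c (4κ - q) telescopes: c q + c (4κ -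
  -- 2q) = c (4κ - q). It also pays for a last run, since q ≤ 2κ.
  induction d generalizing q s with
  | zero =>
    have hk := hgood q s (by simpa using hd)
    by_cases hs : IsDeltaFeasible A b u δ s.x
    · exact ⟨s, .halt q s hs, hs, le_add_of_nonneg_right (mul_nonneg hc (by linarith))⟩
    · refine ⟨_, .retry q s _ hs (.halt _ _ hk), hk, (hcost q s hq).trans ?_⟩
      gcongr
      linarith
  | succ d ih =>
    by_cases hs : IsDeltaFeasible A b u δ s.x
    · exact ⟨s, .halt q s hs, hs, le_add_of_nonneg_right (mul_nonneg hc (by linarith))⟩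
    by_cases hqk : κ ≤ q
    · have hk := hgood q s hqk
      refine ⟨_, .retry q s _ hs (.halt _ _ hk), hk, (hcost q s hq).trans ?_⟩
      gcongr
      linarith
    · push Not at hqk
      obtain ⟨s', l1, l2, l3⟩ := ih (2 * q) (feasibleAttempt A b u δ q s) (by omega)
        (by push_cast; linarith) (by push_cast; rw [pow_succ] at hd; linarith)
      refine ⟨s', .retry q s _ hs l1, l2, l3.trans ?_⟩
      push_cast
      linarith [hcost q s hq]

/-- The rounding error 1 is at most 2 log 2 ≤ 2 log (1 + r). -/
theorem natCeil_log_le {r : ℝ} (hr : 1 ≤ r) :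
    (⌈Real.log r⌉₊ : ℝ) ≤ 3 * Real.log (1 + r) := by
  have h1 := (Nat.ceil_lt_add_one (Real.log_nonneg hr)).le
  have h2 : Real.log r ≤ Real.log (1 + r) := Real.log_le_log (by linarith) (by linarith)
  have h3 : Real.log 2 ≤ Real.log (1 + r) := Real.log_le_log (by norm_num) (by linarith)
  linarith [Real.log_two_gt_d9]

end FirstOrderLP

open FirstOrderLP in
theorem theorem4p1 :
    ∃ C : ℝ, 0 < C ∧
      ∀ (m n : ℕ) (A : Matrix (Fin m) (Fin n) ℝ) (b : Fin m → ℝ) (u : Fin n → ℝ) (δ : ℝ),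
        1 ≤ matOneNorm A → 0 < δ →
        (∃ x : Fin n → ℝ, A.mulVec x = b ∧ x ∈ Set.Icc 0 u) →
        ∃ (x : Fin n → ℝ) (N : ℕ), FeasibleReturns A b u δ x N ∧
          IsDeltaFeasible A b u δ x ∧
          (N : ℝ) ≤ C * (m * matTwoNorm A * circuitImbalance (extendedKernel A) *
            Real.log (1 + m * vecOneNorm b / δ)) := by
  -- 84 = 4 · 3 · 7: the doubling search, the rounding of the number of rounds, and 2e + 1 ≤ 7 for
  -- the rounded round length.
  refine ⟨84, by norm_num, ?_⟩
  rintro m n A b u δ hA hδ ⟨x₀, hsol, hx₀⟩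
  obtain ⟨hA0, hA1⟩ := one_le_card_mul_matTwoNorm hA
  have hκ := one_le_circuitImbalance (extendedKernel A)
  have hb := vecOneNorm_nonneg b
  have hlog : 0 ≤ Real.log (1 + m * vecOneNorm b / δ) :=
    Real.log_nonneg (le_add_of_nonneg_right (by positivity))
  -- If 0 already passes, nothing is run; otherwise ‖b‖₁ > δ, which provides the r ≥ 1 needed to
  -- compare the rounded logarithm with log (1 + r).
  by_cases h0 : IsDeltaFeasible A b u δ 0
  · refine ⟨0, 0, ⟨⟨0, 0, 1, 0⟩, .halt _ _ h0, rfl, rfl⟩, h0, ?_⟩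
    push_cast
    positivity
  have hr : 1 ≤ m * vecOneNorm b / δ := by
    rw [one_le_div hδ]
    have hbδ : δ < vecOneNorm b := by
      by_contra! hle
      refine h0 ⟨⟨le_rfl, hx₀.1.trans hx₀.2⟩, ?_⟩
      have e : vecOneNorm (A.mulVec 0 - b) = vecOneNorm b := by simp [vecOneNorm]
      rw [e]
      exact hle.trans (le_mul_of_one_le_right hδ.le hA)
    have hm : (1 : ℝ) ≤ m := by
      rcases Nat.eq_zero_or_pos m with h | h
      · subst h
        norm_num at hA1
      · exact_mod_cast h
    nlinarith
  have hk := natCeil_log_le hr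
  set ℓ := Real.log (1 + m * vecOneNorm b / δ)
  set κ := circuitImbalance (extendedKernel A)
  have hcost : ∀ (q : ℕ) (s : FGMState n), 1 ≤ q →
      ((feasibleAttempt A b u δ q s).iters : ℝ) ≤
        s.iters + (21 * ℓ * (m * matTwoNorm A)) * q := by
    intro q s hq
    have hq' : (1 : ℝ) ≤ q := by exact_mod_cast hq
    rw [feasibleAttempt_iters hA hx₀ hsol]
    push_cast
    refine add_le_add_right ?_ _
    have h1 : (⌈2 * Real.exp 1 * matTwoNorm A * m * q⌉₊ : ℝ) ≤ 7 * (m * matTwoNorm A * q) := by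
      refine (Nat.ceil_lt_add_one (by positivity)).le.trans ?_
      have h2 : 1 ≤ m * matTwoNorm A * q := one_le_mul_of_one_le_of_one_le hA1 hq'
      nlinarith [Real.exp_one_lt_d9]
    refine (mul_le_mul hk h1 (by positivity) (by positivity)).trans_eq ?_
    ring
  obtain ⟨d, hd⟩ := pow_unbounded_of_one_lt κ (one_lt_two : (1 : ℝ) < 2)
  obtain ⟨s, l1, l2, l3⟩ := exists_feasibleLoop (κ := κ) (by positivity) hcost
    (fun q s hq => feasibleAttempt_isDeltaFeasible hA hδ hx₀ hsol hq s) d 1 ⟨0, 0, 1, 0⟩ le_rfl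
    (by push_cast; linarith) (by push_cast; linarith)
  refine ⟨s.x, s.iters, ⟨s, l1, rfl, rfl⟩, l2, l3.trans ?_⟩
  have hc : 0 ≤ 21 * ℓ * (m * matTwoNorm A) := by positivity
  push_cast
  linarith
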